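/- Let $E=(E^0,E^1,r,s)$ be a directed graph (multiple edges and loops allowed, no cardinality restrictions), let $\operatorname{Path}(E)$ be the set of all finite directed paths of $E$ (vertices being the paths of length $0$), and let $|x|$ be the length of a path $x$. The graph inverse semigroup $G(E)$ is the semigroup with zero generated by $E^0$, $E^1$ and $\{e^{-1} : e\in E^1\}$ subject to the relations, for $a,b\in E^0$ and $e,f\in E^1$: $aa=a$ and $ab=0$ if $a\ne b$; $s(e)e=e\,r(e)=e$; $e^{-1}s(e)=r(e)e^{-1}=e^{-1}$; $e^{-1}e=r(e)$ and $e^{-1}f=0$ if $e\neq f$. Equivalently, it consists of $0$ and the elements $uv^{-1}$ with $u,v\in\operatorname{Path}(E)$, $r(u)=r(v)$, where $u_1v_1^{-1}\cdot u_2v_2^{-1}$ equals $u_1wv_2^{-1}$ if $u_2=v_1w$, equals $u_1(v_2w)^{-1}$ if $v_1=u_2w$, and equals $0$ otherwise; a path $u$ is identified with $u\,r(u)^{-1}$. Suppose that every locally compact Hausdorff topology on $G(E)$ for which all left shifts $s\mapsto xs$ and all right shifts $s\mapsto sx$ are continuous is either compact or discrete. Then: 1. $G(E)$ satisfies condition $(\star)$: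 for every infinite subset $A\subset\operatorname{Path}(E)$ there exist an infinite subset $B\subset A$ and an element $\mu\in G(E)$ such that for each $x\in B$ one has $\mu\cdot x\in\operatorname{Path}(E)$ and $|\mu\cdot x|>|x|$. 2. $E$ cannot be represented as a disjoint union of two graphs $E_1$ and $E_2$ such that the semigroups $G(E_1)$ and $G(E_2)$ are both infinite. -/

import Mathlib

open Quiver

universe v u w

/-- `Path(E)`: the set of all paths of the directed graph with vertex set `V`, a path `⟨a, b, x⟩`
having source `a` and range `b`; every vertex `a` is the path `⟨a, a, nil⟩` of length zero. -/
abbrev GraphPath (V : Type u) [Quiver.{v} V] : Type (max u v) :=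
  Σ a : V, Σ b : V, Quiver.Path a b

/-- The length `|x|` of a path. -/
def GraphPath.length {V : Type u} [Quiver.{v} V] (x : GraphPath V) : ℕ := x.2.2.length

/-- The graph inverse semigroup `G(E)`, through its normal forms: the zero element, and the
elements `u v⁻¹`, where `u` and `v` are paths with the same range `c`. -/
inductive GraphInverseSemigroup (V : Type u) [Quiver.{v} V] : Type (max u v)
  | zero : GraphInverseSemigroup V
  | mk {a b c : V} (u : Quiver.Path a c) (v : Quiver.Path b c) : GraphInverseSemigroup V

namespace GraphInverseSemigroup

section

variable {V : Type u} [Quiver.{v} V]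

instance : Zero (GraphInverseSemigroup V) := ⟨zero⟩

open Classical in
/-- The product of `u₁v₁⁻¹` and `u₂v₂⁻¹` is `u₁w v₂⁻¹` if `u₂ = v₁w`, it is `u₁(v₂w)⁻¹` if
`v₁ = u₂w`, and it is `0` in all other cases. -/
protected noncomputable def mul :
    GraphInverseSemigroup V → GraphInverseSemigroup V → GraphInverseSemigroup V
  | @mk _ _ _ b₁ c₁ u₁ v₁, @mk _ _ a₂ _ c₂ u₂ v₂ =>
    if h : ∃ w : Quiver.Path c₁ c₂, (⟨a₂, c₂, u₂⟩ : GraphPath V) = ⟨b₁, c₂, v₁.comp w⟩ then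
      mk (u₁.comp h.choose) v₂
    else if h : ∃ w : Quiver.Path c₂ c₁, (⟨b₁, c₁, v₁⟩ : GraphPath V) = ⟨a₂, c₁, u₂.comp w⟩ then
      mk u₁ (v₂.comp h.choose)
    else 0
  | _, _ => 0

noncomputable instance : Mul (GraphInverseSemigroup V) := ⟨GraphInverseSemigroup.mul⟩

theorem zero_mul' (x : GraphInverseSemigroup V) : 0 * x = 0 := by
  cases x <;> rfl

theorem mul_zero' (x : GraphInverseSemigroup V) : x * 0 = 0 := by
  cases x <;> rfl

theorem mk_mul_left {a b c d e : V} (u : Quiver.Path a c) (v : Quiver.Path b c)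
    (w : Quiver.Path c d) (z : Quiver.Path e d) : mk u v * mk (v.comp w) z = mk (u.comp w) z := by
  change GraphInverseSemigroup.mul _ _ = _
  have h : ∃ w' : Quiver.Path c d, (⟨b, d, v.comp w⟩ : GraphPath V) = ⟨b, d, v.comp w'⟩ := ⟨w, rfl⟩
  have hw : w = h.choose := by simpa using h.choose_spec
  rw [GraphInverseSemigroup.mul, dif_pos h, ← hw]

theorem mk_mul_right {a b c d e : V} (u : Quiver.Path a d) (v : Quiver.Path b c)
    (w : Quiver.Path c d) (z : Quiver.Path e c) : mk u (v.comp w) * mk v z = mk u (z.comp w) := by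
  change GraphInverseSemigroup.mul _ _ = _
  rw [GraphInverseSemigroup.mul]
  split_ifs with h h'
  · obtain ⟨w', hw'⟩ := h
    have hl := congrArg GraphPath.length hw'
    simp only [GraphPath.length, Quiver.Path.length_comp] at hl
    have h1 : w.length = 0 := by omega
    have hcd := Quiver.Path.eq_of_length_zero w h1
    subst hcd
    obtain rfl := Quiver.Path.eq_nil_of_length_zero w h1
    generalize_proofs hh
    have h2 := congrArg GraphPath.length hh.choose_spec
    simp only [GraphPath.length, Quiver.Path.length_comp] at h2
    rw [Quiver.Path.eq_nil_of_length_zero hh.choose (by omega)]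
    simp
  · rw [← (show w = h'.choose by simpa using h'.choose_spec)]
  · exact absurd ⟨w, rfl⟩ h'

theorem mk_mul_eq_zero {a b c d e f : V} (u : Quiver.Path a c) (v : Quiver.Path b c)
    (y : Quiver.Path d f) (z : Quiver.Path e f)
    (h₁ : ¬∃ w, (⟨d, f, y⟩ : GraphPath V) = ⟨b, f, v.comp w⟩)
    (h₂ : ¬∃ w, (⟨b, c, v⟩ : GraphPath V) = ⟨d, c, y.comp w⟩) : mk u v * mk y z = 0 := by
  change GraphInverseSemigroup.mul _ _ = _
  rw [GraphInverseSemigroup.mul, dif_neg h₁, dif_neg h₂]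

/-- Two prefixes of the same path are comparable. -/
theorem prefix_comparable {a b c d : V} (x : Quiver.Path a b) (y : Quiver.Path a c)
    (p : Quiver.Path b d) (q : Quiver.Path c d) (h : x.comp p = y.comp q) :
    (∃ t, y = x.comp t ∧ p = t.comp q) ∨ (∃ t, x = y.comp t ∧ q = t.comp p) := by
  induction p with
  | nil => exact Or.inr ⟨q, h, rfl⟩
  | cons p e ih =>
    cases q with
    | nil => exact Or.inl ⟨_, h.symm, rfl⟩
    | cons q f =>
      simp only [Quiver.Path.comp_cons] at h
      have := Quiver.Path.obj_eq_of_cons_eq_cons h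
      subst this
      have hp := eq_of_heq (Quiver.Path.heq_of_cons_eq_cons h)
      have he := eq_of_heq (Quiver.Path.hom_heq_of_cons_eq_cons h)
      subst he
      rcases ih q hp with ⟨t, h1, h2⟩ | ⟨t, h1, h2⟩
      · exact Or.inl ⟨t, h1, by rw [h2]; rfl⟩
      · exact Or.inr ⟨t, h1, by rw [h2]; rfl⟩

/-- The three cases of the product. -/
theorem mul_cases {b c d f : V} (v : Quiver.Path b c) (y : Quiver.Path d f) :
    (∃ w, (⟨d, f, y⟩ : GraphPath V) = ⟨b, f, v.comp w⟩) ∨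
    (∃ w, (⟨b, c, v⟩ : GraphPath V) = ⟨d, c, y.comp w⟩) ∨
    ((¬∃ w, (⟨d, f, y⟩ : GraphPath V) = ⟨b, f, v.comp w⟩) ∧
      ¬∃ w, (⟨b, c, v⟩ : GraphPath V) = ⟨d, c, y.comp w⟩) := by
  tauto

protected theorem mul_assoc' (x y z : GraphInverseSemigroup V) : x * y * z = x * (y * z) := by
  rcases x with _ | @⟨a₁, b₁, c₁, u₁, v₁⟩
  · exact (zero_mul' (y * z)).symm ▸ (zero_mul' y).symm ▸ zero_mul' z
  rcases y with _ | @⟨a₂, b₂, c₂, u₂, v₂⟩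
  · change mk u₁ v₁ * 0 * z = mk u₁ v₁ * (0 * z)
    simp only [zero_mul', mul_zero']
  rcases z with _ | @⟨a₃, b₃, c₃, u₃, v₃⟩
  · change mk u₁ v₁ * mk u₂ v₂ * 0 = mk u₁ v₁ * (mk u₂ v₂ * 0)
    simp only [mul_zero']
  rcases mul_cases v₁ u₂ with ⟨w, hw⟩ | ⟨w, hw⟩ | ⟨h₁, h₂⟩
  · cases hw
    rw [mk_mul_left]
    rcases mul_cases v₂ u₃ with ⟨t, ht⟩ | ⟨t, ht⟩ | ⟨k₁, k₂⟩
    · cases ht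
      rw [mk_mul_left, mk_mul_left, Quiver.Path.comp_assoc, Quiver.Path.comp_assoc, mk_mul_left]
    · cases ht
      rw [mk_mul_right, mk_mul_right, mk_mul_left]
    · rw [mk_mul_eq_zero _ _ _ _ k₁ k₂, mk_mul_eq_zero _ _ _ _ k₁ k₂, mul_zero']
  · cases hw
    rw [mk_mul_right]
    rcases mul_cases v₂ u₃ with ⟨t, ht⟩ | ⟨t, ht⟩ | ⟨k₁, k₂⟩
    · cases ht
      rw [mk_mul_left]
      rcases mul_cases (u₂.comp w) (u₂.comp t) with ⟨s, hs⟩ | ⟨s, hs⟩ | ⟨l₁, l₂⟩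
      · have ht : t = w.comp s := by
          rw [Quiver.Path.comp_assoc] at hs; simpa using hs
        subst ht
        rw [← Quiver.Path.comp_assoc, ← Quiver.Path.comp_assoc, mk_mul_left, mk_mul_left]
      · have ht : w = t.comp s := by
          rw [Quiver.Path.comp_assoc] at hs; simpa using hs
        subst ht
        rw [← Quiver.Path.comp_assoc, ← Quiver.Path.comp_assoc, mk_mul_right, mk_mul_right]
      · rw [mk_mul_eq_zero _ _ _ _ l₁ l₂, mk_mul_eq_zero]
        · rintro ⟨s, hs⟩
          rw [Quiver.Path.comp_assoc] at hs
          have ht : t = w.comp s := by simpa using hs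
          exact l₁ ⟨s, by rw [ht, Quiver.Path.comp_assoc]⟩
        · rintro ⟨s, hs⟩
          rw [Quiver.Path.comp_assoc] at hs
          have ht : w = t.comp s := by simpa using hs
          exact l₂ ⟨s, by rw [ht, Quiver.Path.comp_assoc]⟩
    · cases ht
      rw [mk_mul_right, Quiver.Path.comp_assoc, mk_mul_right, mk_mul_right, Quiver.Path.comp_assoc]
    · rw [mk_mul_eq_zero _ _ _ _ k₁ k₂, mul_zero', mk_mul_eq_zero]
      · rintro ⟨s, hs⟩
        exact k₁ ⟨w.comp s, by rw [hs, Quiver.Path.comp_assoc]⟩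
      · rintro ⟨s, hs⟩
        obtain rfl : b₂ = a₃ := congrArg Sigma.fst hs
        have hs : v₂.comp w = u₃.comp s := by simpa using hs
        rcases prefix_comparable _ _ _ _ hs with ⟨t, h, -⟩ | ⟨t, h, -⟩
        · exact k₁ ⟨t, by rw [h]⟩
        · exact k₂ ⟨t, by rw [h]⟩
  · rw [mk_mul_eq_zero _ _ _ _ h₁ h₂, zero_mul']
    rcases mul_cases v₂ u₃ with ⟨t, ht⟩ | ⟨t, ht⟩ | ⟨k₁, k₂⟩
    · cases ht
      rw [mk_mul_left, mk_mul_eq_zero]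
      · rintro ⟨s, hs⟩
        obtain rfl : a₂ = b₁ := congrArg Sigma.fst hs
        have hs : u₂.comp t = v₁.comp s := by simpa using hs
        rcases prefix_comparable _ _ _ _ hs with ⟨t, h, -⟩ | ⟨t, h, -⟩
        · exact h₂ ⟨t, by rw [h]⟩
        · exact h₁ ⟨t, by rw [h]⟩
      · rintro ⟨s, hs⟩
        exact h₂ ⟨t.comp s, by rw [hs, Quiver.Path.comp_assoc]⟩
    · cases ht
      rw [mk_mul_right, mk_mul_eq_zero _ _ _ _ h₁ h₂]
    · rw [mk_mul_eq_zero _ _ _ _ k₁ k₂, mul_zero']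

noncomputable instance : SemigroupWithZero (GraphInverseSemigroup V) where
  mul_assoc := GraphInverseSemigroup.mul_assoc'
  zero_mul := zero_mul'
  mul_zero := mul_zero'

/-- A path `x`, as the element `x r(x)⁻¹` of `G(E)`; this includes vertices and edges. -/
def ofPath (x : GraphPath V) : GraphInverseSemigroup V := mk x.2.2 Quiver.Path.nil

/-- The inverse edge `e⁻¹`, as an element of `G(E)`. -/
def edgeInv {a b : V} (e : a ⟶ b) : GraphInverseSemigroup V := mk Quiver.Path.nil e.toPath

end

/-- The defining relations of a graph inverse semigroup, for images `p`, `e`, `e'` of the vertices,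
the edges and the inverse edges in a semigroup with zero. -/
structure Relations (V : Type u) [Quiver.{v} V] {S : Type w} [SemigroupWithZero S] (p : V → S)
    (e e' : ∀ {a b : V}, (a ⟶ b) → S) : Prop where
  vertex_self : ∀ a, p a * p a = p a
  vertex_ne : ∀ a b, a ≠ b → p a * p b = 0
  source_edge : ∀ {a b : V} (f : a ⟶ b), p a * e f = e f
  edge_range : ∀ {a b : V} (f : a ⟶ b), e f * p b = e f
  inv_source : ∀ {a b : V} (f : a ⟶ b), e' f * p a = e' f
  range_inv : ∀ {a b : V} (f : a ⟶ b), p b * e' f = e' f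
  inv_edge_self : ∀ {a b : V} (f : a ⟶ b), e' f * e f = p b
  inv_edge_ne : ∀ {a b c d : V} (f : a ⟶ b) (g : c ⟶ d),
    (⟨a, b, f⟩ : Σ a b : V, a ⟶ b) ≠ ⟨c, d, g⟩ → e' f * e g = 0

section

variable {V : Type u} [Quiver.{v} V]

/-- The vertices, edges and inverse edges of `G(E)` satisfy the defining relations. -/
theorem relations : Relations V (fun a => ofPath ⟨a, a, Quiver.Path.nil⟩)
    (fun {a b} f => ofPath ⟨a, b, f.toPath⟩) (fun {_ _} f => edgeInv f) where
  vertex_self a := mk_mul_left _ _ Quiver.Path.nil _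
  vertex_ne a b h := by
    apply mk_mul_eq_zero
    · rintro ⟨w, hw⟩; exact h (congrArg Sigma.fst hw).symm
    · rintro ⟨w, hw⟩; exact h (congrArg Sigma.fst hw)
  source_edge {a b} f := by
    have := mk_mul_left (Quiver.Path.nil : Quiver.Path a a) Quiver.Path.nil f.toPath
      (Quiver.Path.nil : Quiver.Path b b)
    rwa [Quiver.Path.nil_comp] at this
  edge_range {a b} f := mk_mul_left _ _ Quiver.Path.nil _
  inv_source {a b} f := by
    have := mk_mul_right (Quiver.Path.nil : Quiver.Path b b)
      (Quiver.Path.nil : Quiver.Path a a) f.toPath Quiver.Path.nil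
    rwa [Quiver.Path.nil_comp] at this
  range_inv {a b} f := mk_mul_left _ _ Quiver.Path.nil _
  inv_edge_self {a b} f := mk_mul_left _ _ Quiver.Path.nil _
  inv_edge_ne {a b c d} f g h := by
    apply mk_mul_eq_zero
    · rintro ⟨w, hw⟩
      have hl := congrArg GraphPath.length hw
      simp only [GraphPath.length, Quiver.Path.length_comp, Quiver.Path.length_toPath] at hl
      cases w with
      | nil => cases hw; exact h rfl
      | cons w k => simp at hl
    · rintro ⟨w, hw⟩
      have hl := congrArg GraphPath.length hw
      simp only [GraphPath.length, Quiver.Path.length_comp, Quiver.Path.length_toPath] at hl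
      cases w with
      | nil => cases hw; exact h rfl
      | cons w k => simp at hl

/-- Two paths are comparable, or start at different vertices, or diverge at some edge. -/
theorem path_trichotomy {a b d : V} (x : Quiver.Path a d) (y : Quiver.Path a b) :
    (∃ w, y = x.comp w) ∨ (∃ w, x = y.comp w) ∨
    ∃ (c c₁ c₂ : V) (t : Quiver.Path a c) (f : c ⟶ c₁) (g : c ⟶ c₂) (x' : Quiver.Path c₁ d)
      (y' : Quiver.Path c₂ b), (⟨c, c₁, f⟩ : Σ a b : V, a ⟶ b) ≠ ⟨c, c₂, g⟩ ∧
      x = t.comp (f.toPath.comp x') ∧ y = t.comp (g.toPath.comp y') := by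
  induction y with
  | nil => exact Or.inr (Or.inl ⟨x, by simp⟩)
  | @cons b e y g ih =>
    rcases ih with ⟨w, hw⟩ | ⟨w, hw⟩ | ⟨c, c₁, c₂, t, f, k, x', y', h, hx, hy⟩
    · exact Or.inl ⟨w.cons g, by rw [hw]; rfl⟩
    · subst hw
      have key : ∀ {d : V} (w : Quiver.Path b d), w.length = 0 ∨
          ∃ (m : V) (f : b ⟶ m) (w' : Quiver.Path m d), w = f.toPath.comp w' := by
        intro d w
        induction w with
        | nil => exact Or.inl rfl
        | cons w f ih =>
          rcases ih with h | ⟨m, k, w', rfl⟩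
          · obtain rfl := Quiver.Path.eq_of_length_zero w h
            obtain rfl := Quiver.Path.eq_nil_of_length_zero w h
            exact Or.inr ⟨_, f, Quiver.Path.nil, rfl⟩
          · exact Or.inr ⟨m, k, w'.cons f, rfl⟩
      rcases key w with h | ⟨m, f, w', rfl⟩
      · obtain rfl := Quiver.Path.eq_of_length_zero w h
        obtain rfl := Quiver.Path.eq_nil_of_length_zero w h
        exact Or.inl ⟨g.toPath, rfl⟩
      · by_cases hfg : (⟨b, m, f⟩ : Σ a b : V, a ⟶ b) = ⟨b, e, g⟩
        · cases hfg
          exact Or.inr (Or.inl ⟨w', by rw [← Quiver.Path.comp_assoc]; rfl⟩)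
        · exact Or.inr (Or.inr ⟨b, m, e, y, f, g, w', Quiver.Path.nil, hfg, rfl, rfl⟩)
    · exact Or.inr (Or.inr ⟨c, c₁, c₂, t, f, k, x', y'.cons g, h, hx, by rw [hy]; rfl⟩)

section

variable {S : Type w} [SemigroupWithZero S] (p : V → S) (e e' : ∀ {a b : V}, (a ⟶ b) → S)

/-- The image of a path under an assignment of vertices and edges. -/
def pathImage {a : V} : ∀ {b : V}, Quiver.Path a b → S
  | _, Quiver.Path.nil => p a
  | _, Quiver.Path.cons x f => pathImage x * e f

/-- The image of an inverse path under an assignment of vertices and inverse edges. -/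
def invPathImage {a : V} : ∀ {b : V}, Quiver.Path a b → S
  | _, Quiver.Path.nil => p a
  | _, Quiver.Path.cons x f => e' f * invPathImage x

/-- The map out of `G(E)` induced by an assignment of vertices, edges and inverse edges. -/
def liftFun : GraphInverseSemigroup V → S
  | zero => 0
  | mk u v => pathImage p e u * invPathImage p e' v

variable {p e e'}

theorem pathImage_range (h : Relations V p e e') {a b : V} (x : Quiver.Path a b) :
    pathImage p e x * p b = pathImage p e x := by
  cases x with
  | nil => exact h.vertex_self a
  | cons x f => rw [pathImage, mul_assoc, h.edge_range]

theorem pathImage_source (h : Relations V p e e') {a b : V} (x : Quiver.Path a b) :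
    p a * pathImage p e x = pathImage p e x := by
  induction x with
  | nil => exact h.vertex_self a
  | cons x f ih => rw [pathImage, ← mul_assoc, ih]

theorem invPathImage_range (h : Relations V p e e') {a b : V} (x : Quiver.Path a b) :
    p b * invPathImage p e' x = invPathImage p e' x := by
  cases x with
  | nil => exact h.vertex_self a
  | cons x f => rw [invPathImage, ← mul_assoc, h.range_inv]

theorem invPathImage_source (h : Relations V p e e') {a b : V} (x : Quiver.Path a b) :
    invPathImage p e' x * p a = invPathImage p e' x := by
  induction x with
  | nil => exact h.vertex_self a
  | cons x f ih => rw [invPathImage, mul_assoc, ih]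

theorem pathImage_comp (h : Relations V p e e') {a b c : V} (x : Quiver.Path a b)
    (y : Quiver.Path b c) : pathImage p e (x.comp y) = pathImage p e x * pathImage p e y := by
  induction y with
  | nil => exact (pathImage_range h x).symm
  | cons y f ih => rw [Quiver.Path.comp_cons, pathImage, ih, pathImage, mul_assoc]

theorem invPathImage_comp (h : Relations V p e e') {a b c : V} (x : Quiver.Path a b)
    (y : Quiver.Path b c) :
    invPathImage p e' (x.comp y) = invPathImage p e' y * invPathImage p e' x := by
  induction y with
  | nil => exact (invPathImage_range h x).symm
  | cons y f ih => rw [Quiver.Path.comp_cons, invPathImage, ih, invPathImage, mul_assoc]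

theorem inv_mul_self (h : Relations V p e e') {a b : V} (x : Quiver.Path a b) :
    invPathImage p e' x * pathImage p e x = p b := by
  induction x with
  | nil => exact h.vertex_self a
  | cons x f ih =>
    rw [invPathImage, pathImage, mul_assoc, ← mul_assoc _ _ (e f), ih, h.source_edge,
      h.inv_edge_self]

theorem toPath_image (h : Relations V p e e') {a b : V} (f : a ⟶ b) :
    pathImage p e f.toPath = e f := h.source_edge f

theorem toPath_invImage (h : Relations V p e e') {a b : V} (f : a ⟶ b) :
    invPathImage p e' f.toPath = e' f := h.inv_source f

theorem inv_mul_prefix (h : Relations V p e e') {a b c : V} (x : Quiver.Path a b)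
    (y : Quiver.Path b c) :
    invPathImage p e' x * pathImage p e (x.comp y) = pathImage p e y := by
  rw [pathImage_comp h, ← mul_assoc, inv_mul_self h, pathImage_source h]

theorem prefix_inv_mul (h : Relations V p e e') {a b c : V} (x : Quiver.Path a b)
    (y : Quiver.Path b c) :
    invPathImage p e' (x.comp y) * pathImage p e x = invPathImage p e' y := by
  rw [invPathImage_comp h, mul_assoc, inv_mul_self h, invPathImage_source h]

theorem inv_mul_eq_zero (h : Relations V p e e') {b c d f : V} (v : Quiver.Path b c)
    (y : Quiver.Path d f) (h₁ : ¬∃ w, (⟨d, f, y⟩ : GraphPath V) = ⟨b, f, v.comp w⟩)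
    (h₂ : ¬∃ w, (⟨b, c, v⟩ : GraphPath V) = ⟨d, c, y.comp w⟩) :
    invPathImage p e' v * pathImage p e y = 0 := by
  by_cases hbd : b = d
  · subst hbd
    rcases path_trichotomy v y with ⟨w, rfl⟩ | ⟨w, rfl⟩ | ⟨_, _, _, t, f, g, x', y', hn, rfl, rfl⟩
    · exact absurd ⟨w, rfl⟩ h₁
    · exact absurd ⟨w, rfl⟩ h₂
    · rw [invPathImage_comp h, mul_assoc, inv_mul_prefix h, invPathImage_comp h, pathImage_comp h,
        toPath_image h, toPath_invImage h, mul_assoc, ← mul_assoc (e' f), h.inv_edge_ne _ _ hn,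
        zero_mul, mul_zero]
  · rw [← invPathImage_source h, ← pathImage_source h, mul_assoc, ← mul_assoc (p b),
      h.vertex_ne _ _ hbd, zero_mul, mul_zero]

theorem liftFun_mul (h : Relations V p e e') (x y : GraphInverseSemigroup V) :
    liftFun p e e' (x * y) = liftFun p e e' x * liftFun p e e' y := by
  rcases x with _ | @⟨a₁, b₁, c₁, u₁, v₁⟩
  · change liftFun p e e' (0 * y) = 0 * _
    rw [zero_mul, zero_mul]; rfl
  rcases y with _ | @⟨a₂, b₂, c₂, u₂, v₂⟩
  · change liftFun p e e' (mk u₁ v₁ * 0) = _ * 0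
    rw [mul_zero, mul_zero]; rfl
  have hr : liftFun p e e' (mk u₁ v₁) * liftFun p e e' (mk u₂ v₂) = pathImage p e u₁ *
      ((invPathImage p e' v₁ * pathImage p e u₂) * invPathImage p e' v₂) := by
    simp only [liftFun, mul_assoc]
  rw [hr]
  rcases mul_cases v₁ u₂ with ⟨w, hw⟩ | ⟨w, hw⟩ | ⟨h₁, h₂⟩
  · cases hw
    rw [mk_mul_left, inv_mul_prefix h, ← mul_assoc, ← pathImage_comp h]; rfl
  · cases hw
    rw [mk_mul_right, prefix_inv_mul h, ← invPathImage_comp h]; rfl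
  · rw [mk_mul_eq_zero _ _ _ _ h₁ h₂, inv_mul_eq_zero h _ _ h₁ h₂, zero_mul, mul_zero]; rfl

end

/-- `G(E)` is the semigroup with zero presented by the vertices, the edges and the inverse edges
subject to the defining relations. -/
theorem existsUnique_lift {S : Type w} [SemigroupWithZero S] (p : V → S)
    (e e' : ∀ {a b : V}, (a ⟶ b) → S) (h : Relations V p e e') :
    ∃! φ : GraphInverseSemigroup V →ₙ* S, φ 0 = 0 ∧
      (∀ a, φ (ofPath ⟨a, a, Quiver.Path.nil⟩) = p a) ∧
      (∀ {a b : V} (f : a ⟶ b), φ (ofPath ⟨a, b, f.toPath⟩) = e f) ∧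
      (∀ {a b : V} (f : a ⟶ b), φ (edgeInv f) = e' f) := by
  refine ⟨⟨liftFun p e e', liftFun_mul h⟩, ⟨rfl, ?_, ?_, ?_⟩, ?_⟩
  · exact fun a => h.vertex_self a
  · intro a b f
    change pathImage p e f.toPath * p b = e f
    rw [toPath_image h, h.edge_range]
  · intro a b f
    change p b * invPathImage p e' f.toPath = e' f
    rw [toPath_invImage h, h.range_inv]
  · rintro φ ⟨h0, hp, he, he'⟩
    have h1 : ∀ {a b : V} (x : Quiver.Path a b), φ (mk x Quiver.Path.nil) = pathImage p e x := by
      intro a b x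
      induction x with
      | nil => exact hp a
      | cons x f ih =>
        have := mk_mul_left x Quiver.Path.nil f.toPath Quiver.Path.nil
        rw [Quiver.Path.nil_comp] at this
        rw [pathImage, ← ih, ← he f, ← map_mul]
        exact congrArg φ this.symm
    have h2 : ∀ {a b : V} (x : Quiver.Path a b), φ (mk Quiver.Path.nil x) = invPathImage p e' x := by
      intro a b x
      induction x with
      | nil => exact hp a
      | cons x f ih =>
        have := mk_mul_right Quiver.Path.nil Quiver.Path.nil f.toPath x
        rw [Quiver.Path.nil_comp] at this
        rw [invPathImage, ← ih, ← he' f, ← map_mul]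
        exact congrArg φ this.symm
    ext x
    cases x with
    | zero => exact h0
    | mk u v =>
      have := mk_mul_left u Quiver.Path.nil Quiver.Path.nil v
      simp only [Quiver.Path.comp_nil] at this
      change φ (mk u v) = pathImage p e u * invPathImage p e' v
      rw [← h1, ← h2, ← map_mul, this]

end

end GraphInverseSemigroup

/-- Every Hausdorff locally compact shift-continuous topology on the semigroup `S` is compact or
discrete. -/
def CompactOrDiscreteDichotomy (S : Type u) [Mul S] : Prop :=
  ∀ [TopologicalSpace S], T2Space S → LocallyCompactSpace S → SeparatelyContinuousMul S →
    CompactSpace S ∨ DiscreteTopology S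

/-- Condition (⋆) on the graph inverse semigroup over `V`. The path `y` is the product `μ · x`. -/
def ConditionStar (V : Type u) [Quiver.{v} V] : Prop :=
  ∀ A : Set (GraphPath V), A.Infinite → ∃ B ⊆ A, B.Infinite ∧ ∃ μ : GraphInverseSemigroup V,
    ∀ x ∈ B, ∃ y : GraphPath V, μ * GraphInverseSemigroup.ofPath x = GraphInverseSemigroup.ofPath y ∧
      x.length < y.length

/-- The subgraph induced on a set of vertices. -/
instance inducedSubgraph {V : Type u} [Quiver.{v} V] (X : Set V) : Quiver.{v} X :=
  ⟨fun a b => (a : V) ⟶ (b : V)⟩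

/-- The graph on `V` is the disjoint union of the subgraphs induced on `X` and `Y`: every vertex
lies in exactly one of `X` and `Y`, and every edge has both ends in `X` or both ends in `Y`. -/
def IsDisjointUnionOfSubgraphs {V : Type u} [Quiver.{v} V] (X Y : Set V) : Prop :=
  IsCompl X Y ∧ ∀ (a b : V), (a ⟶ b) → (a ∈ X ∧ b ∈ X) ∨ (a ∈ Y ∧ b ∈ Y)

/-! ### The one-point-compactification topology attached to a subset -/

section DichotomyObstruction

open Filter Topology

variable {S : Type u}

/-! Given a set `K`, isolate every nonzero point and let the neighbourhoods of `0` be the sets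
containing `0` and almost all of `K`. This topology is Hausdorff and locally compact, is not
discrete if `K` is infinite and not compact if its complement is. In `G(E)` a shift has finite
fibres over nonzero points, so all shifts are continuous as soon as each sends almost all of `K`
into `K ∪ {0}`. The dichotomy therefore forbids such a `K`, and the theorem comes from well-chosen
candidates.

Half of an infinite family of vertices shows that `V` is finite. The elements `u v⁻¹` with range in
one component give the second claim. The nonzero elements not of the form `(q e)(q' e)⁻¹` show that
an infinite emitter is the end of infinitely many paths; by induction it is then the end of
arbitrarily long ones.

For (⋆), let `A` be a counterexample. If infinitely many members of `A` extend `v`, no path `u` into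
the range of `v` is longer than `v`, since `μ = u v⁻¹` would lengthen them all. That range is thus a
finite emitter, and a König-style descent gives such a `v` of every length. Since `V` is finite, two
of them, of different lengths, share a range, and the longer contradicts the bound for the shorter.
-/

theorem isCompact_nhdsAdjoint {z : S} {K s : Set S} (hz : z ∈ s) (hs : s ⊆ insert z K) :
    @IsCompact S (nhdsAdjoint z (cofinite ⊓ 𝓟 K)) s := by
  let _ := nhdsAdjoint z (cofinite ⊓ 𝓟 K)
  rw [isCompact_iff_ultrafilter_le_nhds]
  intro f hf
  -- A nonprincipal ultrafilter on `s` avoids `z`, hence contains `K` and converges to `z`; a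
  -- principal one converges to its own point.
  rcases f.le_cofinite_or_eq_pure with h | ⟨a, rfl⟩
  · refine ⟨z, hz, ?_⟩
    rw [nhds_nhdsAdjoint_same]
    refine le_trans (le_inf h ?_) le_sup_right
    rw [le_principal_iff] at hf ⊢
    have h1 : ({z}ᶜ : Set S) ∈ (f : Filter S) := h (by simp)
    filter_upwards [hf, h1] with x hx hxz
    exact (hs hx).resolve_left hxz
  · exact ⟨a, by simpa using hf, pure_le_nhds a⟩

theorem t2Space_nhdsAdjoint {z : S} {K : Set S} :
    @T2Space S (nhdsAdjoint z (cofinite ⊓ 𝓟 K)) := by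
  let _ := nhdsAdjoint z (cofinite ⊓ 𝓟 K)
  rw [t2Space_iff_disjoint_nhds]
  have key : ∀ y, y ≠ z → Disjoint (𝓝 y) (𝓝 z) := by
    intro y hy
    rw [nhds_nhdsAdjoint_same, nhds_nhdsAdjoint_of_ne _ hy, disjoint_sup_right]
    constructor
    · simpa using hy
    · refine Disjoint.mono_right inf_le_left ?_
      rw [Filter.disjoint_iff]
      exact ⟨{y}, by simp, {y}ᶜ, by simp, disjoint_compl_right⟩
  intro x y hxy
  by_cases hy : y = z
  · subst hy; exact key x hxy
  by_cases hx : x = z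
  · subst hx; exact (key y hy).symm
  · rw [nhds_nhdsAdjoint_of_ne _ hx, nhds_nhdsAdjoint_of_ne _ hy]
    simpa using hxy

theorem locallyCompactSpace_nhdsAdjoint {z : S} {K : Set S} :
    @LocallyCompactSpace S (nhdsAdjoint z (cofinite ⊓ 𝓟 K)) := by
  let _ := nhdsAdjoint z (cofinite ⊓ 𝓟 K)
  refine ⟨fun x n hn => ?_⟩
  by_cases hx : x = z
  · subst hx
    refine ⟨n ∩ insert x K, inter_mem hn ?_, Set.inter_subset_left,
      isCompact_nhdsAdjoint ⟨mem_of_mem_nhds hn, Set.mem_insert _ _⟩ Set.inter_subset_right⟩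
    rw [nhds_nhdsAdjoint_same]
    exact ⟨by simp, mem_inf_of_right (by simp)⟩
  · refine ⟨{x}, ?_, by simpa using mem_of_mem_nhds hn, isCompact_singleton⟩
    rw [nhds_nhdsAdjoint_of_ne _ hx]
    simp

theorem not_compactSpace_nhdsAdjoint {z : S} {K : Set S} (hK : Kᶜ.Infinite) :
    ¬ @CompactSpace S (nhdsAdjoint z (cofinite ⊓ 𝓟 K)) := by
  let _ := nhdsAdjoint z (cofinite ⊓ 𝓟 K)
  intro hc
  have : (cofinite ⊓ 𝓟 Kᶜ : Filter S).NeBot := Filter.cofinite_inf_principal_neBot_iff.2 hK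
  obtain ⟨f, hf⟩ := Ultrafilter.exists_le (cofinite ⊓ 𝓟 Kᶜ : Filter S)
  have h1 := hf.trans inf_le_left
  have h2 := hf.trans inf_le_right
  obtain ⟨x, -, hx⟩ := isCompact_iff_ultrafilter_le_nhds.1 hc.isCompact_univ f (by simp)
  have h3 : ({x}ᶜ : Set S) ∈ (f : Filter S) := h1 (by simp)
  have h4 : Kᶜ ∈ (f : Filter S) := le_principal_iff.1 h2
  -- `insert x K` is a neighbourhood of `x` whether or not `x = z`, yet `f` lives on `Kᶜ` and avoids
  -- `x`.
  have h5 : insert x K ∈ (f : Filter S) := by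
    apply hx
    by_cases hxz : x = z
    · subst hxz
      rw [nhds_nhdsAdjoint_same]
      exact ⟨by simp, mem_inf_of_right (by simp)⟩
    · rw [nhds_nhdsAdjoint_of_ne _ hxz]
      simp
  obtain ⟨y, ⟨hy3, hy4⟩, hy5⟩ := f.nonempty_of_mem (inter_mem (inter_mem h3 h4) h5)
  exact hy5.elim hy3 hy4

theorem not_discreteTopology_nhdsAdjoint {z : S} {K : Set S} (hK : K.Infinite) :
    ¬ @DiscreteTopology S (nhdsAdjoint z (cofinite ⊓ 𝓟 K)) := by
  let _ := nhdsAdjoint z (cofinite ⊓ 𝓟 K)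
  intro hd
  have h1 : ({z} : Set S) ∈ 𝓝 z := by simp [nhds_discrete]
  rw [nhds_nhdsAdjoint_same] at h1
  have h2 := h1.2
  rw [mem_inf_principal, mem_cofinite] at h2
  refine hK ((h2.insert z).subset fun x hx => ?_)
  by_cases hxz : x = z
  · exact Or.inl hxz
  · exact Or.inr fun h => hxz (h hx)

/-- Only continuity at `z` matters. If `U` is a neighbourhood of `z`, a point of `K` sent outside
`U` lands either in the finite set `K \ U`, whose fibres are finite, or outside `K ∪ {z}`, which
happens finitely often. -/
theorem continuous_nhdsAdjoint_of_almost_invariant {z : S} {K : Set S} {f : S → S} (hz : f z = z)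
    (hf : ∀ y, y ≠ z → (f ⁻¹' {y}).Finite) (hK : {x ∈ K | f x ∉ K ∧ f x ≠ z}.Finite) :
    @Continuous S S (nhdsAdjoint z (cofinite ⊓ 𝓟 K)) (nhdsAdjoint z (cofinite ⊓ 𝓟 K)) f := by
  let _ := nhdsAdjoint z (cofinite ⊓ 𝓟 K)
  rw [continuous_nhdsAdjoint_dom, hz, nhds_nhdsAdjoint_same]
  intro U hU
  obtain ⟨hzU, hU⟩ := hU
  rw [mem_pure] at hzU
  rw [mem_inf_principal, mem_cofinite] at hU
  rw [mem_map, mem_inf_principal, mem_cofinite]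
  have hfin : (⋃ y ∈ {x | x ∈ K → x ∈ U}ᶜ, f ⁻¹' {y}).Finite := by
    refine hU.biUnion fun y hy => hf y ?_
    rintro rfl
    exact hy fun _ => hzU
  refine (hfin.union hK).subset fun x hx => ?_
  simp only [Set.mem_compl_iff, Set.mem_ofPred_eq, Classical.not_imp, Set.mem_preimage] at hx
  by_cases hxK : f x ∈ K
  · left
    simp only [Set.mem_iUnion]
    exact ⟨f x, by simpa using ⟨hxK, hx.2⟩, rfl⟩
  · exact Or.inr ⟨hx.1, hxK, fun h => hx.2 (h ▸ hzU)⟩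

/-- An infinite, coinfinite subset that is almost invariant under all shifts yields a topology
which is neither compact nor discrete. -/
theorem not_compactOrDiscreteDichotomy [SemigroupWithZero S] {K : Set S} (hinf : K.Infinite)
    (hcoinf : Kᶜ.Infinite)
    (hl : ∀ m y : S, y ≠ 0 → {x | m * x = y}.Finite)
    (hr : ∀ m y : S, y ≠ 0 → {x | x * m = y}.Finite)
    (hKl : ∀ m : S, {x ∈ K | m * x ∉ K ∧ m * x ≠ 0}.Finite)
    (hKr : ∀ m : S, {x ∈ K | x * m ∉ K ∧ x * m ≠ 0}.Finite) :
    ¬ CompactOrDiscreteDichotomy S := by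
  intro h
  let _ := nhdsAdjoint (0 : S) (cofinite ⊓ 𝓟 K)
  rcases h t2Space_nhdsAdjoint locallyCompactSpace_nhdsAdjoint
    { continuous_const_mul := fun {a} =>
        continuous_nhdsAdjoint_of_almost_invariant (mul_zero a) (hl a) (hKl a)
      continuous_mul_const := fun {a} =>
        continuous_nhdsAdjoint_of_almost_invariant (zero_mul a) (hr a) (hKr a) } with h | h
  · exact not_compactSpace_nhdsAdjoint hcoinf h
  · exact not_discreteTopology_nhdsAdjoint hinf h

end DichotomyObstruction

/-! ### Inversion and finiteness of the fibres of shifts -/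

namespace GraphInverseSemigroup

variable {V : Type u} [Quiver.{v} V]

/-- The inversion `u v⁻¹ ↦ v u⁻¹`. -/
def inv : GraphInverseSemigroup V → GraphInverseSemigroup V
  | zero => zero
  | mk u v => mk v u

theorem inv_inv (x : GraphInverseSemigroup V) : inv (inv x) = x := by cases x <;> rfl

theorem inv_involutive : Function.Involutive (inv : GraphInverseSemigroup V → _) := inv_inv

theorem inv_eq_zero {x : GraphInverseSemigroup V} : inv x = 0 ↔ x = 0 := by
  change inv x = inv 0 ↔ _
  exact inv_involutive.injective.eq_iff

theorem mk_ne_zero {a b c : V} (u : Quiver.Path a c) (v : Quiver.Path b c) :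
    mk u v ≠ (0 : GraphInverseSemigroup V) := nofun

theorem inv_mul (x y : GraphInverseSemigroup V) : inv (x * y) = inv y * inv x := by
  rcases x with _ | @⟨a₁, b₁, c₁, u₁, v₁⟩
  · exact (congrArg inv (zero_mul y)).trans (mul_zero (inv y)).symm
  rcases y with _ | @⟨a₂, b₂, c₂, u₂, v₂⟩
  · exact (congrArg inv (mul_zero (mk u₁ v₁))).trans (zero_mul (inv (mk u₁ v₁))).symm
  rcases mul_cases v₁ u₂ with ⟨w, hw⟩ | ⟨w, hw⟩ | ⟨h₁, h₂⟩
  · cases hw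
    rw [mk_mul_left]
    exact (mk_mul_right _ _ _ _).symm
  · cases hw
    rw [mk_mul_right]
    exact (mk_mul_left _ _ _ _).symm
  · rw [mk_mul_eq_zero _ _ _ _ h₁ h₂]
    exact (mk_mul_eq_zero _ _ _ _ h₂ h₁).symm

/-- The three cases of a left shift. -/
theorem mul_mk_cases {a b c d e : V} (p : Quiver.Path a c) (q : Quiver.Path b c)
    (u : Quiver.Path d e) {f : V} (w : Quiver.Path f e) :
    (∃ t : Quiver.Path c e, mk u w = mk (q.comp t) w ∧ mk p q * mk u w = mk (p.comp t) w) ∨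
    (∃ t : Quiver.Path e c, (⟨b, c, q⟩ : GraphPath V) = ⟨d, c, u.comp t⟩ ∧
      mk p q * mk u w = mk p (w.comp t)) ∨
    mk p q * mk u w = 0 := by
  rcases mul_cases q u with ⟨t, ht⟩ | ⟨t, ht⟩ | ⟨h₁, h₂⟩
  · cases ht
    exact Or.inl ⟨t, rfl, mk_mul_left _ _ _ _⟩
  · refine Or.inr (Or.inl ⟨t, ht, ?_⟩)
    cases ht
    exact mk_mul_right _ _ _ _
  · exact Or.inr (Or.inr (mk_mul_eq_zero _ _ _ _ h₁ h₂))

/-- For `m = p q⁻¹` and `x = u w⁻¹`, a nonzero product is `(p t) w⁻¹` with `u = q t`, or `p (w t)⁻¹`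
with `q = u t`. Cancelling `t` or `p`, the value determines `x` in the first case, and in the second
once `|t| ≤ |q|` is known. -/
theorem finite_setOf_mul_eq (m y : GraphInverseSemigroup V) (hy : y ≠ 0) :
    {x | m * x = y}.Finite := by
  rcases m with _ | @⟨a, b, c, p, q⟩
  · convert Set.finite_empty
    ext x
    simpa using fun h => hy (h.symm.trans (zero_mul x))
  set S₁ : Set (GraphInverseSemigroup V) :=
    {x | ∃ (e f : V) (t : Quiver.Path c e) (w : Quiver.Path f e), x = mk (q.comp t) w ∧
      mk (p.comp t) w = y} with hS₁
  set S₂ : ℕ → Set (GraphInverseSemigroup V) := fun n =>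
    {x | ∃ (e f : V) (u : Quiver.Path b e) (w : Quiver.Path f e) (t : Quiver.Path e c),
      t.length = n ∧ q = u.comp t ∧ x = mk u w ∧ mk p (w.comp t) = y} with hS₂
  have h₁ : S₁.Subsingleton := by
    rintro _ ⟨e, f, t, w, rfl, rfl⟩ _ ⟨e', f', t', w', rfl, h⟩
    obtain ⟨-, rfl, rfl, h1, h2⟩ := mk.inj h
    obtain rfl := eq_of_heq h2
    have h3 := eq_of_heq h1
    rw [Quiver.Path.comp_inj_right] at h3
    rw [h3]
  have h₂ : ∀ n, (S₂ n).Subsingleton := by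
    intro n
    -- Two prefixes of `q` are comparable, and complements of equal length force them to coincide;
    -- this is one of the two symmetric orientations.
    have key : ∀ {e e' f f' : V} (u : Quiver.Path b e) (w : Quiver.Path f e)
        (t : Quiver.Path e c) (u' : Quiver.Path b e') (w' : Quiver.Path f' e')
        (t' : Quiver.Path e' c), t.length = t'.length → ∀ s : Quiver.Path e e', u' = u.comp s →
        t = s.comp t' → mk p (w'.comp t') = mk p (w.comp t) → mk u w = mk u' w' := by
      intro e e' f f' u w t u' w' t' hl s hu ht h
      have hl' := congrArg Quiver.Path.length ht
      rw [Quiver.Path.length_comp] at hl'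
      have hs : s.length = 0 := by omega
      obtain rfl := Quiver.Path.eq_of_length_zero s hs
      obtain rfl := Quiver.Path.eq_nil_of_length_zero s hs
      rw [Quiver.Path.nil_comp] at ht
      rw [Quiver.Path.comp_nil] at hu
      subst ht hu
      obtain ⟨-, rfl, -, -, h2⟩ := mk.inj h
      have h3 := eq_of_heq h2
      rw [Quiver.Path.comp_inj_left] at h3
      rw [h3]
    rintro _ ⟨e, f, u, w, t, hl, hq, rfl, rfl⟩ _ ⟨e', f', u', w', t', hl', hq', rfl, h⟩
    rcases prefix_comparable u u' t t' (hq.symm.trans hq') with ⟨s, hs, hs'⟩ | ⟨s, hs, hs'⟩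
    · exact key u w t u' w' t' (hl.trans hl'.symm) s hs hs' h
    · exact (key u' w' t' u w t (hl'.trans hl.symm) s hs hs' h.symm).symm
  have hfin : (S₁ ∪ ⋃ n ∈ Set.Iic q.length, S₂ n).Finite :=
    h₁.finite.union ((Set.finite_Iic _).biUnion fun n _ => (h₂ n).finite)
  refine hfin.subset fun x hx => ?_
  rcases x with _ | @⟨d, f, e, u, w⟩
  · exact absurd ((mul_zero (mk p q)).symm.trans hx).symm hy
  change mk p q * mk u w = y at hx
  rcases mul_mk_cases p q u w with ⟨t, h, h'⟩ | ⟨t, h, h'⟩ | h'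
  · exact Or.inl ⟨e, f, t, w, h, h'.symm.trans hx⟩
  · right
    obtain rfl : b = d := congrArg Sigma.fst h
    have hq : q = u.comp t := by simpa using h
    simp only [Set.mem_iUnion]
    refine ⟨t.length, ?_, e, f, u, w, t, rfl, hq, rfl, h'.symm.trans hx⟩
    rw [Set.mem_Iic, hq, Quiver.Path.length_comp]
    omega
  · exact absurd (hx.symm.trans h') hy

theorem finite_setOf_mul_eq' (m y : GraphInverseSemigroup V) (hy : y ≠ 0) :
    {x | x * m = y}.Finite := by
  have h := (finite_setOf_mul_eq (inv m) (inv y) (by rwa [Ne, inv_eq_zero])).image inv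
  refine h.subset fun x hx => ⟨inv x, ?_, inv_inv x⟩
  change inv m * inv x = inv y
  rw [← inv_mul, show x * m = y from hx]

/-- An infinite, coinfinite set that is closed under inversion and almost invariant under left
shifts contradicts the dichotomy. -/
theorem not_dichotomy_of_almost_invariant {K : Set (GraphInverseSemigroup V)} (hinf : K.Infinite)
    (hcoinf : Kᶜ.Infinite) (hinv : ∀ x ∈ K, inv x ∈ K)
    (hK : ∀ m : GraphInverseSemigroup V, {x ∈ K | m * x ∉ K ∧ m * x ≠ 0}.Finite) :
    ¬ CompactOrDiscreteDichotomy (GraphInverseSemigroup V) := by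
  refine not_compactOrDiscreteDichotomy hinf hcoinf finite_setOf_mul_eq finite_setOf_mul_eq' hK
    fun m => ((hK (inv m)).image inv).subset ?_
  rintro x ⟨hx, hx', hx0⟩
  refine ⟨inv x, ⟨hinv x hx, ?_, ?_⟩, inv_inv x⟩
  · rw [← inv_mul]
    intro h
    exact hx' (inv_inv (x * m) ▸ hinv _ h)
  · rwa [← inv_mul, Ne, inv_eq_zero]

/-! ### Finiteness of the vertex set -/

/-- The vertex `a`, as an element of `G(E)`. -/
def vertex (a : V) : GraphInverseSemigroup V := mk (Quiver.Path.nil : Quiver.Path a a) .nil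

theorem vertex_injective : Function.Injective (vertex : V → GraphInverseSemigroup V) :=
  fun _ _ h => (mk.inj h).1

theorem finite_of_dichotomy (h : CompactOrDiscreteDichotomy (GraphInverseSemigroup V)) :
    Finite V := by
  by_contra hV
  rw [not_finite_iff_infinite] at hV
  have f := Infinite.natEmbedding V
  have hg : Function.Injective fun n => vertex (f n) := vertex_injective.comp f.injective
  refine not_dichotomy_of_almost_invariant (K := Set.range fun n => vertex (f (2 * n)))
    ?_ ?_ ?_ ?_ h
  · exact Set.infinite_range_of_injective fun m n hmn => by
      have : 2 * m = 2 * n := hg hmn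
      omega
  · refine (Set.infinite_range_of_injective (f := fun n => vertex (f (2 * n + 1)))
      fun m n hmn => ?_).mono ?_
    · have : 2 * m + 1 = 2 * n + 1 := hg hmn
      omega
    · rintro _ ⟨n, rfl⟩ ⟨m, hm⟩
      have : 2 * m = 2 * n + 1 := hg hm
      omega
  · rintro _ ⟨n, rfl⟩
    exact ⟨n, rfl⟩
  · intro m
    rcases m with _ | @⟨a, b, c, p, q⟩
    · refine Set.finite_empty.subset ?_
      rintro x ⟨-, -, hx⟩
      exact hx (zero_mul x)
    -- Multiplication by `p q⁻¹` kills every vertex except the source `b` of `q`.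
    · refine (Set.finite_singleton (vertex b)).subset ?_
      rintro _ ⟨⟨n, rfl⟩, -, hx⟩
      by_contra hne
      refine hx (mk_mul_eq_zero _ _ _ _ ?_ ?_)
      · rintro ⟨w, hw⟩
        exact hne (congrArg vertex (congrArg Sigma.fst hw))
      · rintro ⟨w, hw⟩
        exact hne (congrArg vertex (congrArg Sigma.fst hw).symm)

/-! ### Disjoint unions -/

/-- The nonzero elements `u v⁻¹` for which the common range of `u` and `v` lies in `X`. -/
def rangeIn (X : Set V) : Set (GraphInverseSemigroup V) :=
  {x | ∃ (a b c : V) (u : Quiver.Path a c) (v : Quiver.Path b c), c ∈ X ∧ x = mk u v}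

/-- The inclusion of an induced subgraph. -/
def subgraphInclusion (X : Set V) : X ⥤q V where
  obj a := a
  map e := e

theorem mapPath_subgraphInclusion_injective {X : Set V} {a b : X} :
    Function.Injective fun p : Quiver.Path a b => (subgraphInclusion X).mapPath p := by
  intro p
  induction p with
  | nil =>
    rintro q h
    have hl := congrArg Quiver.Path.length h
    generalize hq : q = q' at h hl
    cases q' with
    | nil => rfl
    | cons q f => simp at hl
  | @cons b c p e ih =>
    intro q h
    cases q with
    | nil =>
      have hl := congrArg Quiver.Path.length h
      simp at hl
    | @cons b' _ q f =>
      simp only [Prefunctor.mapPath_cons] at h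
      obtain rfl : b = b' := Subtype.ext (Quiver.Path.obj_eq_of_cons_eq_cons h)
      obtain rfl := ih (eq_of_heq (Quiver.Path.heq_of_cons_eq_cons h))
      have he := eq_of_heq (Quiver.Path.hom_heq_of_cons_eq_cons h)
      obtain rfl : e = f := he
      rfl

/-- The map `G(E₁) → G(E)` induced by the inclusion of an induced subgraph. -/
def ofSubgraph (X : Set V) : GraphInverseSemigroup X → GraphInverseSemigroup V
  | zero => 0
  | mk u v => mk ((subgraphInclusion X).mapPath u) ((subgraphInclusion X).mapPath v)

theorem ofSubgraph_injective (X : Set V) : Function.Injective (ofSubgraph X) := by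
  rintro (_ | @⟨⟨a, ha⟩, ⟨b, hb⟩, ⟨c, hc⟩, u, v⟩) (_ | @⟨⟨a', ha'⟩, ⟨b', hb'⟩, ⟨c', hc'⟩, u', v'⟩) h
  · rfl
  · exact absurd h.symm (mk_ne_zero _ _)
  · exact absurd h (mk_ne_zero _ _)
  · obtain ⟨h1, h2, h3, h4, h5⟩ := mk.inj h
    change a = a' at h1
    change b = b' at h2
    change c = c' at h3
    subst h1 h2 h3
    rw [mapPath_subgraphInclusion_injective (eq_of_heq h4),
      mapPath_subgraphInclusion_injective (eq_of_heq h5)]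

theorem rangeIn_infinite (X : Set V) [Infinite (GraphInverseSemigroup X)] :
    (rangeIn X).Infinite := by
  have h := (Set.infinite_range_of_injective (ofSubgraph_injective X)).sdiff (Set.finite_singleton 0)
  refine h.mono ?_
  rintro _ ⟨⟨x, rfl⟩, hx⟩
  rcases x with _ | @⟨a, b, c, u, v⟩
  · exact absurd rfl hx
  · exact ⟨_, _, _, _, _, c.2, rfl⟩

theorem range_mem_iff {X Y : Set V} (h : IsDisjointUnionOfSubgraphs X Y) {a b : V}
    (p : Quiver.Path a b) : a ∈ X ↔ b ∈ X := by
  induction p with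
  | nil => rfl
  | @cons b c p e ih =>
    rw [ih]
    have hd := h.1.disjoint
    rcases h.2 _ _ e with ⟨h1, h2⟩ | ⟨h1, h2⟩
    · exact iff_of_true h1 h2
    · exact iff_of_false (fun h => hd.le_bot ⟨h, h1⟩) (fun h => hd.le_bot ⟨h, h2⟩)

theorem not_disjointUnion_of_dichotomy (h : CompactOrDiscreteDichotomy (GraphInverseSemigroup V)) :
    ¬ ∃ X Y : Set V, IsDisjointUnionOfSubgraphs X Y ∧
      Infinite (GraphInverseSemigroup X) ∧ Infinite (GraphInverseSemigroup Y) := by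
  rintro ⟨X, Y, hXY, hX, hY⟩
  refine not_dichotomy_of_almost_invariant (rangeIn_infinite X)
    ((rangeIn_infinite Y).mono ?_) ?_ (fun m => Set.finite_empty.subset ?_) h
  · rintro _ ⟨a, b, c, u, v, hc, rfl⟩ ⟨a', b', c', u', v', hc', h⟩
    obtain ⟨-, -, rfl, -, -⟩ := mk.inj h
    exact hXY.1.disjoint.le_bot ⟨hc', hc⟩
  · rintro _ ⟨a, b, c, u, v, hc, rfl⟩
    exact ⟨_, _, _, v, u, hc, rfl⟩
  · rintro _ ⟨⟨a, b, c, u, v, hc, rfl⟩, hm, hm0⟩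
    rcases m with _ | @⟨_, _, _, p, q⟩
    · exact hm0 (zero_mul _)
    -- A nonzero shift keeps the common range or moves it along the path `t`, which stays in the
    -- same component; no exceptions occur.
    rcases mul_mk_cases p q u v with ⟨t, h, h'⟩ | ⟨t, h, h'⟩ | h'
    · exact hm ⟨_, _, _, _, _, hc, h'⟩
    · exact hm ⟨_, _, _, _, _, (range_mem_iff hXY t).1 hc, h'⟩
    · exact hm0 h'

/-! ### Infinite emitters -/

/-- A vertex emitting infinitely many edges. -/
def InfiniteEmitter (c : V) : Prop := Infinite (Σ d : V, c ⟶ d)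

/-- The elements `(q e)(q' e)⁻¹` for edges `e` with source `c`. -/
def throughEdge (c : V) : Set (GraphInverseSemigroup V) :=
  {x | ∃ (a b d : V) (q : Quiver.Path a c) (q' : Quiver.Path b c) (e : c ⟶ d),
    x = mk (q.cons e) (q'.cons e)}

/-- The left factor `p = q e` already fixes `q` and `e`, so only `q'` varies, among the finitely
many paths into `c`. -/
theorem finite_throughEdge_fixed_left {c : V} [Finite (Σ a : V, Quiver.Path a c)] {a d : V}
    (p : Quiver.Path a d) : {x ∈ throughEdge c | ∃ (b : V) (w : Quiver.Path b d),
      x = mk p w}.Finite := by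
  rcases p with _ | ⟨q₀, e₀⟩
  · refine Set.finite_empty.subset ?_
    rintro _ ⟨⟨a, b, d, q, q', e, rfl⟩, b', w, h⟩
    obtain ⟨rfl, -, rfl, h, -⟩ := mk.inj h
    exact Quiver.Path.cons_ne_nil _ _ (eq_of_heq h)
  · rename_i c'
    by_cases hc : c' = c
    · subst hc
      refine (Set.finite_range fun r : Σ a : V, Quiver.Path a c' =>
        mk (q₀.cons e₀) (r.2.cons e₀)).subset ?_
      rintro _ ⟨⟨a, b, d, q, q', e, rfl⟩, b', w, h⟩
      obtain ⟨rfl, -, rfl, h, -⟩ := mk.inj h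
      obtain rfl := eq_of_heq (Quiver.Path.hom_heq_of_cons_eq_cons (eq_of_heq h))
      obtain rfl := eq_of_heq (Quiver.Path.heq_of_cons_eq_cons (eq_of_heq h))
      exact ⟨⟨b, q'⟩, rfl⟩
    · refine Set.finite_empty.subset ?_
      rintro _ ⟨⟨a, b, d, q, q', e, rfl⟩, b', w, h⟩
      obtain ⟨rfl, -, rfl, h, -⟩ := mk.inj h
      exact hc (Quiver.Path.obj_eq_of_cons_eq_cons (eq_of_heq h)).symm

theorem not_dichotomy_of_infiniteEmitter {c : V} (hc : InfiniteEmitter c)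
    [Finite (Σ a : V, Quiver.Path a c)] :
    ¬ CompactOrDiscreteDichotomy (GraphInverseSemigroup V) := by
  have hc : Infinite (Σ d : V, c ⟶ d) := hc
  have hmem : ∀ {x : GraphInverseSemigroup V}, x ∉ (throughEdge c ∪ {0})ᶜ → x ≠ 0 →
      x ∈ throughEdge c := fun hx hx0 => (not_not.1 hx).resolve_right hx0
  refine not_dichotomy_of_almost_invariant (K := (throughEdge c ∪ {0})ᶜ) ?_ ?_ ?_ ?_
  · refine (Set.infinite_range_of_injective (f := fun e : Σ d : V, c ⟶ d =>
      (mk e.2.toPath .nil : GraphInverseSemigroup V)) ?_).mono ?_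
    · rintro ⟨d, e⟩ ⟨d', e'⟩ h
      obtain ⟨-, rfl, -, h, -⟩ := mk.inj h
      obtain rfl := eq_of_heq (Quiver.Path.hom_heq_of_cons_eq_cons (eq_of_heq h))
      rfl
    · rintro _ ⟨e, rfl⟩ (⟨a, b, d, q, q', e', h⟩ | h)
      · obtain ⟨-, rfl, rfl, -, h⟩ := mk.inj h
        exact Quiver.Path.nil_ne_cons _ _ (eq_of_heq h)
      · exact mk_ne_zero _ _ h
  · rw [compl_compl]
    refine (Set.infinite_range_of_injective (f := fun e : Σ d : V, c ⟶ d =>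
      (mk e.2.toPath e.2.toPath : GraphInverseSemigroup V)) ?_).mono ?_
    · rintro ⟨d, e⟩ ⟨d', e'⟩ h
      obtain ⟨-, -, rfl, h, -⟩ := mk.inj h
      obtain rfl := eq_of_heq (Quiver.Path.hom_heq_of_cons_eq_cons (eq_of_heq h))
      rfl
    · rintro _ ⟨e, rfl⟩
      exact Or.inl ⟨_, _, _, .nil, .nil, e.2, rfl⟩
  · rintro x hx hx'
    refine hx (hx'.imp ?_ fun h => inv_eq_zero.1 h)
    rintro ⟨a, b, d, q, q', e, h⟩
    exact ⟨b, a, d, q', q, e, by rw [← inv_inv x, h]; rfl⟩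
  · intro m
    rcases m with _ | @⟨a, b, c₁, p, q⟩
    · refine Set.finite_empty.subset ?_
      rintro x ⟨-, -, hx⟩
      exact hx (zero_mul x)
    have hfin := (finite_throughEdge_fixed_left (c := c) p).biUnion
      (t := fun y => {x | mk p q * x = y}) (by
        rintro _ ⟨-, b', w, rfl⟩
        exact finite_setOf_mul_eq _ _ (mk_ne_zero _ _))
    refine hfin.subset ?_
    rintro x ⟨hx, hmx, hmx0⟩
    have hC := hmem hmx hmx0
    -- A product that enters `throughEdge c` from outside has left factor exactly `p`: finitely many
    -- values, each with a finite fibre.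
    suffices ∃ (b' : V) (w : Quiver.Path b' c₁), mk p q * x = mk p w by
      simp only [Set.mem_iUnion]
      exact ⟨_, ⟨hC, this⟩, rfl⟩
    rcases x with _ | @⟨d, f, e, u, w⟩
    · exact absurd (mul_zero _) hmx0
    rcases mul_mk_cases p q u w with ⟨t, h, h'⟩ | ⟨t, h, h'⟩ | h'
    · rw [h'] at hC ⊢
      rcases t with _ | ⟨t, k⟩
      · exact ⟨f, w, rfl⟩
      -- Here the left factors of `x` and of the product both end in the edge `k`, and the right
      -- factor is unchanged, so `x` was already in `throughEdge c`.
      · exfalso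
        obtain ⟨a', b', d', q₀, q₁, e', h2⟩ := hC
        rw [Quiver.Path.comp_cons] at h2
        obtain ⟨rfl, rfl, rfl, h3, h4⟩ := mk.inj h2
        obtain rfl := Quiver.Path.obj_eq_of_cons_eq_cons (eq_of_heq h3)
        obtain rfl := eq_of_heq (Quiver.Path.hom_heq_of_cons_eq_cons (eq_of_heq h3))
        obtain rfl := eq_of_heq h4
        exact hx (Or.inl ⟨_, _, _, q.comp t, q₁, k, h⟩)
    · exact ⟨f, _, h'⟩
    · exact absurd h' hmx0

/-- Paths are counted backwards from `c`: the last edge starts at one of finitely many vertices,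
each of which is a finite emitter if it has an edge to `c`. Excluding length zero leaves `c` itself
free to be an infinite emitter. -/
theorem finite_paths_of_length [Finite V] (n : ℕ) (c : V)
    (hc : ∀ (a : V) (q : Quiver.Path a c), q.length ≠ 0 → ¬ InfiniteEmitter a) :
    {q : Σ a : V, Quiver.Path a c | q.2.length = n}.Finite := by
  induction n generalizing c with
  | zero =>
    refine (Set.finite_singleton ⟨c, Quiver.Path.nil⟩).subset ?_
    rintro ⟨a, q⟩ hq
    change q.length = 0 at hq
    obtain rfl := Quiver.Path.eq_of_length_zero q hq
    rw [Quiver.Path.eq_nil_of_length_zero q hq]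
    rfl
  | succ n ih =>
    have hfin : ∀ b : V, (⋃ e : b ⟶ c, (fun q : Σ a : V, Quiver.Path a b =>
        (⟨q.1, q.2.cons e⟩ : Σ a : V, Quiver.Path a c)) '' {q | q.2.length = n}).Finite := by
      intro b
      by_cases hb : IsEmpty (b ⟶ c)
      · simp
      · rw [not_isEmpty_iff] at hb
        obtain ⟨e₀⟩ := hb
        have hbf : Finite (Σ d : V, b ⟶ d) :=
          not_infinite_iff_finite.1 (hc b e₀.toPath (by simp))
        have : Finite (b ⟶ c) := Finite.of_injective (fun e => (⟨c, e⟩ : Σ d : V, b ⟶ d))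
          fun e e' h => by simpa using h
        exact Set.finite_iUnion fun e => (ih b fun a q _ => hc a (q.cons e) (by simp)).image _
    refine (Set.finite_iUnion hfin).subset ?_
    rintro ⟨a, q⟩ hq
    cases q with
    | nil => simp at hq
    | @cons b _ q e =>
      simp only [Set.mem_iUnion]
      exact ⟨b, e, ⟨a, q⟩, by simpa using hq, rfl⟩

theorem infiniteEmitter_unbounded_of_dichotomy
    (h : CompactOrDiscreteDichotomy (GraphInverseSemigroup V)) (n : ℕ) :
    ∀ c : V, (∀ (a : V) (q : Quiver.Path a c), q.length ≤ n) → ¬ InfiniteEmitter c := by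
  have := finite_of_dichotomy h
  induction n using Nat.strong_induction_on with
  | _ n ih =>
    intro c hn hc
    have hfin : (⋃ k ∈ Set.Iic n, {q : Σ a : V, Quiver.Path a c | q.2.length = k}).Finite := by
      refine (Set.finite_Iic n).biUnion fun k _ => finite_paths_of_length k c fun a q hq => ?_
      -- Prefixing `q` by a path into `a` gives a path into `c`, so lengths of paths into `a` are
      -- bounded by `n - |q| < n`.
      refine ih (n - q.length) ?_ a fun a' q' => ?_
      · have := hn a q
        omega
      · have := hn a' (q'.comp q)
        rw [Quiver.Path.length_comp] at this
        omega
    have : Finite (Σ a : V, Quiver.Path a c) := by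
      rw [← Set.finite_univ_iff]
      refine hfin.subset fun q _ => ?_
      simpa using hn q.1 q.2
    exact not_dichotomy_of_infiniteEmitter hc h

/-! ### Condition (⋆) -/

/-- The paths having `v` as a prefix. -/
def extensions {a c : V} (v : Quiver.Path a c) : Set (GraphPath V) :=
  {x | ∃ (b : V) (w : Quiver.Path c b), x = ⟨a, b, v.comp w⟩}

theorem extensions_subset {a c : V} (v : Quiver.Path a c) :
    extensions v ⊆ {⟨a, c, v⟩} ∪ ⋃ e : Σ d : V, c ⟶ d, extensions (v.cons e.2) := by
  rintro _ ⟨b, w, rfl⟩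
  by_cases hw : w.length = 0
  · left
    obtain rfl := Quiver.Path.eq_of_length_zero w hw
    rw [Quiver.Path.eq_nil_of_length_zero w hw]
    rfl
  · right
    obtain ⟨d, e, w', -, rfl⟩ := Quiver.Path.eq_toPath_comp_of_length_eq_succ w
      (Nat.succ_pred_eq_of_ne_zero hw).symm
    simp only [Set.mem_iUnion]
    exact ⟨⟨d, e⟩, b, w', by rw [← Quiver.Path.comp_assoc, Quiver.Path.comp_toPath_eq_cons]⟩

theorem conditionStar_of_dichotomy (h : CompactOrDiscreteDichotomy (GraphInverseSemigroup V)) :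
    ConditionStar V := by
  have := finite_of_dichotomy h
  by_contra hs
  simp only [ConditionStar, not_forall] at hs
  obtain ⟨A, hA, hs⟩ := hs
  have hbound : ∀ {a c : V} (v : Quiver.Path a c), (A ∩ extensions v).Infinite →
      ∀ (d : V) (u : Quiver.Path d c), u.length ≤ v.length := by
    intro a c v hv d u
    by_contra! hlt
    refine hs ⟨A ∩ extensions v, Set.inter_subset_left, hv, mk u v, ?_⟩
    rintro _ ⟨-, b, w, rfl⟩
    refine ⟨⟨d, b, u.comp w⟩, mk_mul_left _ _ _ _, ?_⟩
    simp only [GraphPath.length, Quiver.Path.length_comp]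
    omega
  -- König-style descent: `V` is finite, and by `hbound` the range of each chosen `v` is a finite
  -- emitter, so some one-edge extension still has infinitely many extensions in `A`.
  have hex : ∀ n : ℕ, ∃ (a c : V) (v : Quiver.Path a c), v.length = n ∧
      (A ∩ extensions v).Infinite := by
    intro n
    induction n with
    | zero =>
      by_contra! hno
      have hfin : ∀ a : V, (A ∩ extensions (Quiver.Path.nil : Quiver.Path a a)).Finite :=
        fun a => hno a a .nil rfl
      refine hA ((Set.finite_iUnion hfin).subset ?_)
      rintro ⟨a, b, x⟩ hx
      simp only [Set.mem_iUnion]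
      exact ⟨a, hx, b, x, by simp⟩
    | succ n ih =>
      obtain ⟨a, c, v, hv, hinf⟩ := ih
      have hfe : Finite (Σ d : V, c ⟶ d) := not_infinite_iff_finite.1
        (infiniteEmitter_unbounded_of_dichotomy h _ c (hbound v hinf))
      by_contra! hno
      have hfin : ∀ e : Σ d : V, c ⟶ d, (A ∩ extensions (v.cons e.2)).Finite :=
        fun e => hno a e.1 (v.cons e.2) (by simp [hv])
      refine hinf (((Set.finite_singleton ⟨a, c, v⟩).union (Set.finite_iUnion hfin)).subset ?_)
      rintro x ⟨hxA, hx⟩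
      refine (extensions_subset v hx).imp id fun hx' => ?_
      simp only [Set.mem_iUnion] at hx' ⊢
      exact hx'.imp fun e he => ⟨hxA, he⟩
  choose a c v hl hinf using hex
  have hle : ∀ m n, c m = c n → m ≤ n := by
    intro m n hmn
    -- The endpoint is generalized to `z` so that `v m` can be compared with `v n` without a cast.
    have key : ∀ z, z = c n → ∀ u : Quiver.Path (a m) z, u.length ≤ n := by
      rintro _ rfl u
      exact (hbound (v n) (hinf n) (a m) u).trans_eq (hl n)
    exact (hl m).symm.trans_le (key _ hmn (v m))
  exact not_injective_infinite_finite c fun m n hmn => (hle m n hmn).antisymm (hle n m hmn.symm)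

end GraphInverseSemigroup

theorem mainTheorem5 {V : Type u} [Quiver.{v} V]
    (h : CompactOrDiscreteDichotomy (GraphInverseSemigroup V)) :
    ConditionStar V ∧
      ¬ ∃ X Y : Set V, IsDisjointUnionOfSubgraphs X Y ∧
        Infinite (GraphInverseSemigroup X) ∧ Infinite (GraphInverseSemigroup Y) :=
  ⟨GraphInverseSemigroup.conditionStar_of_dichotomy h,
    GraphInverseSemigroup.not_disjointUnion_of_dichotomy h⟩
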